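/- **Conventions.** A *valued differential field* $(K,\Gamma;v)$ is a field $K$ with a derivation $f\mapsto f'$ and a surjective (Krull) valuation $v:K^\times\to\Gamma$ onto an ordered abelian group $\Gamma$, whose residue field $\mathcal O/\mathfrak m$ has characteristic $0$; here $\mathcal O=\{f: v(f)\ge 0\}$ (with $v(0)=\infty$) and $\mathfrak m$ is its maximal ideal. It is *monotone* if $v(f')\ge v(f)$ for all $f\in K$; then $\mathcal O$ and $\mathfrak m$ are closed under the derivation, and the residue field carries the induced derivation. It is *differential-henselian* if every differential polynomial $P\in\mathcal O\{Y\}=\mathcal O[Y,Y',Y'',\dots]$ whose reduction over the residue field has total degree $1$ has a zero in $\mathcal O$. A *lift of the differential residue field* is a differential subfield $\boldsymbol k$ of $K$ contained in $\mathcal O$ that the residue map $\mathcal O\to\mathcal O/\mathfrak m$ maps isomorphically onto the residue field. For $f\in K^\times$ put $f^\dagger=f'/f$. A *cross-section* of $v$ is a group morphism $s:\Gamma\to K^\times$ with $v(s(\gamma))=\gamma$ for all $\gamma\in\Gamma$. The two-sorted structure $((K,\boldsymbol k),\Gamma;v)$ consists of the differential field $K$ with the distinguished subset $\boldsymbol k$,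 the ordered abelian group $\Gamma$, and the map $v$; it is *$\aleph_1$-saturated* if, for every countable set of parameters and either of the two sorts, every finitely satisfiable set of first-order formulas over these parameters in one free variable of that sort is realized in the structure. **Theorem 3.5.** Let $(K,\Gamma;v)$ be a monotone differential-henselian valued differential field and let $\boldsymbol k$ be a lift of its differential residue field. Suppose the two-sorted structure $((K,\boldsymbol k),\Gamma;v)$ is $\aleph_1$-saturated. Then there are a cross-section $s:\Gamma\to K^\times$ of $v$ and an additive map $c:\Gamma\to\boldsymbol k$ such that $s(\gamma)^\dagger=c(\gamma)$ for all $\gamma\in\Gamma$. -/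

import Mathlib

open scoped Differential

/-! ### Saturation of first-order structures -/

namespace FirstOrder.Language

/-- `M` is `κ`-saturated: for every parameter set `A ⊆ M` of cardinality `< κ`, every set `p` of
`L`-formulas over `A` in one free variable that is finitely satisfiable in `M` is realized in `M`.
The variables indexed by `A` are interpreted by the parameters themselves, and the variable
indexed by `Unit` is the free one. -/
def IsSaturated (L : Language.{0, 0}) (M : Type*) [L.Structure M] (κ : Cardinal) : Prop :=
  ∀ A : Set M, Cardinal.mk A < κ → ∀ p : Set (L.Formula (A ⊕ Unit)),
    (∀ q ⊆ p, q.Finite → ∃ x : M, ∀ φ ∈ q, φ.Realize (Sum.elim Subtype.val fun _ => x)) →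
    ∃ x : M, ∀ φ ∈ p, φ.Realize (Sum.elim Subtype.val fun _ => x)

end FirstOrder.Language

namespace ValDiff

variable {K Γ : Type*} [Field K] [AddCommGroup Γ] [LinearOrder Γ] [IsOrderedAddMonoid Γ]

/-! ### Valued differential fields

Valuations are written additively, `v : AddValuation K (WithTop Γ)`, with `v a = ⊤` exactly when
`a = 0`; so `v` restricts to a map from the nonzero elements of `K` to `Γ`. -/

/-- The valuation ring `𝒪 = {a : v a ≥ 0}`. -/
abbrev valRing (v : AddValuation K (WithTop Γ)) : ValuationSubring K :=
  v.toValuation.valuationSubring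

theorem mem_valRing_iff (v : AddValuation K (WithTop Γ)) (a : K) : a ∈ valRing v ↔ 0 ≤ v a :=
  Iff.rfl

/-- The residue field of the valuation ring. -/
abbrev ResField (v : AddValuation K (WithTop Γ)) : Type _ :=
  IsLocalRing.ResidueField (valRing v)

/-- A differential field `K` with valuation `v` is a valued differential field with value
group `Γ`: every element of `Γ` is the valuation of a nonzero element (nonzero is automatic, as
`v 0 = ⊤`), and the residue field has characteristic zero. -/
structure IsValuedDifferentialField (v : AddValuation K (WithTop Γ)) : Prop where
  surj : ∀ γ : Γ, ∃ a : K, v a = γ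
  charZero : CharZero (ResField v)

/-- `v` is monotone: `v (a′) ≥ v a` for all `a`. In particular the derivation is small and maps
the valuation ring into itself. -/
def IsMonotone [Differential K] (v : AddValuation K (WithTop Γ)) : Prop :=
  ∀ a : K, v a ≤ v (a′)

/-- Differential-henselianity: every differential polynomial over the valuation ring whose
reduction to the residue field has total degree `1` has a zero in the valuation ring.
The ring of differential polynomials `𝒪{Y} = 𝒪[Y, Y′, Y″, …]` is `MvPolynomial ℕ 𝒪`, with
`MvPolynomial.X n` standing for the `n`-th derivative of `Y`; it is evaluated in `K` at
`(y, y′, y″, …)`. -/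
def IsDHenselian [Differential K] (v : AddValuation K (WithTop Γ)) : Prop :=
  ∀ P : MvPolynomial ℕ (valRing v),
    (MvPolynomial.map (IsLocalRing.residue (valRing v)) P).totalDegree = 1 →
    ∃ y ∈ valRing v, MvPolynomial.aeval (fun n => (fun a : K => a′)^[n] y) P = 0

/-- `k` is a lift of the differential residue field: a differential subfield of `K` contained in
the valuation ring that is mapped bijectively onto the residue field by the residue map.
The derivation of the residue field is the one induced by that of `K`, so that this
bijection is an isomorphism of differential fields. -/
structure IsLift [Differential K] (v : AddValuation K (WithTop Γ)) (k : Subfield K) : Prop where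
  deriv_mem : ∀ a ∈ k, a′ ∈ k
  le_valRing : ∀ a ∈ k, a ∈ valRing v
  bijective : Function.Bijective
    fun a : k => IsLocalRing.residue (valRing v) ⟨a, le_valRing a a.2⟩

/-! ### The two-sorted structure `((K, k), Γ; v)`

As usual, a structure with sorts `K` and `Γ` is construed as a one-sorted structure on the disjoint
union of `K` and `Γ`, with predicates for the two sorts and with (possibly partial) operations given by
their graphs. -/

/-- The relation symbols: the two sorts, the distinguished subset of the field sort, the graph of
the derivation, the graph of the valuation on nonzero field elements, the order of the value
group, and the graphs of the field addition, the field multiplication and the group addition. -/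
inductive Rel : ℕ → Type
  | fieldSort : Rel 1
  | groupSort : Rel 1
  | lift : Rel 1
  | deriv : Rel 2
  | val : Rel 2
  | groupLe : Rel 2
  | fieldAdd : Rel 3
  | fieldMul : Rel 3
  | groupAdd : Rel 3

/-- The language of the structures `((K, k), Γ; v)`. -/
abbrev lang : FirstOrder.Language.{0, 0} := ⟨fun _ => Empty, Rel⟩

/-- The underlying set of the structure `((K, k), Γ; v)`: the disjoint union of `K` and `Γ`. The
parameters `v` and `k` do not affect this set; they determine the interpretation of the symbols. -/
inductive Pair (v : AddValuation K (WithTop Γ)) (k : Subfield K) : Type _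
  | field (a : K) : Pair v k
  | group (γ : Γ) : Pair v k

instance [Differential K] (v : AddValuation K (WithTop Γ)) (k : Subfield K) :
    lang.Structure (Pair v k) where
  funMap f := nomatch f
  RelMap
    | Rel.fieldSort => fun x => ∃ a : K, x 0 = Pair.field a
    | Rel.groupSort => fun x => ∃ γ : Γ, x 0 = Pair.group γ
    | Rel.lift => fun x => ∃ a ∈ k, x 0 = Pair.field a
    | Rel.deriv => fun x => ∃ a : K, x 0 = Pair.field a ∧ x 1 = Pair.field (a′)
    | Rel.val => fun x => ∃ (a : K) (γ : Γ), v a = γ ∧ x 0 = Pair.field a ∧ x 1 = Pair.group γ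
    | Rel.groupLe => fun x => ∃ γ δ : Γ, γ ≤ δ ∧ x 0 = Pair.group γ ∧ x 1 = Pair.group δ
    | Rel.fieldAdd => fun x => ∃ a b : K,
        x 0 = Pair.field a ∧ x 1 = Pair.field b ∧ x 2 = Pair.field (a + b)
    | Rel.fieldMul => fun x => ∃ a b : K,
        x 0 = Pair.field a ∧ x 1 = Pair.field b ∧ x 2 = Pair.field (a * b)
    | Rel.groupAdd => fun x => ∃ γ δ : Γ,
        x 0 = Pair.group γ ∧ x 1 = Pair.group δ ∧ x 2 = Pair.group (γ + δ)

/-! ### Cross-sections -/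

/-- `s : Γ → Kˣ` is a cross-section of `v`: a group morphism with `v (s γ) = γ`. -/
def IsCrossSection (v : AddValuation K (WithTop Γ)) (s : Multiplicative Γ →* Kˣ) : Prop :=
  ∀ γ : Γ, v (s (Multiplicative.ofAdd γ) : K) = γ

end ValDiff

/-! Let `G` be the group of nonzero `a` with `a†` in `k`. A homomorphic section `s` of `v` on `G` is
all that is needed, since then `c γ = (s γ)†` is additive.

The valuation maps `G` onto `Γ`: for any `b ≠ 0`, monotonicity and the lift give `b† = c + ε` with
`c` in `k` and `ε` infinitesimal, and differential-henselianity gives a unit `u` with `u† = -ε`, so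
that `b * u` lies in `G` (`exists_val_eq_logDeriv_mem`).

The obstruction to a section lies in Ext(Γ, U), where `U` is the kernel of `v` on `G`. Being
ordered, `Γ` is torsion-free and embeds in a `ℚ`-vector space, so Ext(ℚ, U) = 0 suffices. As `ℚ` is
the union of the groups `(1 / n!)ℤ`, this vanishing amounts to solving all systems `x n = h n * x (n
+ 1) ^ (n + 1)` in `U` (`exists_section_of_torsionFree`). Any finite part is solved backwards from
`1`; since `U` is definable, saturation solves the whole system (`exists_isLogUnit_seq`). -/

/-! ### Lifting homomorphisms out of torsion-free abelian groups -/

/-- A homomorphism `ℚ → D` is determined by a compatible system of images of `1 / n!`. -/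
theorem exists_rat_addMonoidHom {D : Type*} [AddCommGroup D] (d : ℕ → D)
    (hd : ∀ n, d n = (n + 1) • d (n + 1)) :
    ∃ ψ : ℚ →+ D, ∀ (q : ℚ) (n : ℕ) (a : ℤ), q * (n.factorial : ℚ) = a → ψ q = a • d n := by
  have hstep : ∀ n j : ℕ, ∃ t : ℕ, (n + j).factorial = t * n.factorial ∧ d n = t • d (n + j) := by
    intro n j
    induction j with
    | zero => exact ⟨1, by simp, by simp⟩
    | succ j ih =>
      obtain ⟨t, ht, hdt⟩ := ih
      refine ⟨(n + j + 1) * t, ?_, ?_⟩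
      · rw [← add_assoc, Nat.factorial_succ, ht, mul_assoc]
      · rw [hdt, hd (n + j), ← mul_smul, mul_comm t, ← add_assoc]
  have hint : ∀ q : ℚ, q * (q.den.factorial : ℚ) = (q.num * (q.den - 1).factorial : ℤ) := by
    intro q
    rw [← Nat.mul_factorial_pred q.den_nz]
    push_cast
    rw [← mul_assoc, Rat.mul_den_eq_num]
  have hle : ∀ (q : ℚ) (n j : ℕ) (a b : ℤ), q * (n.factorial : ℚ) = a →
      q * ((n + j).factorial : ℚ) = b → a • d n = b • d (n + j) := by
    intro q n j a b ha hb
    obtain ⟨t, ht, hdt⟩ := hstep n j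
    have hab : b = a * t := by
      have : (b : ℚ) = a * t := by rw [← hb, ← ha, ht]; push_cast; ring
      exact_mod_cast this
    rw [hdt, hab, mul_smul, natCast_zsmul]
  have hwd : ∀ (q : ℚ) (n m : ℕ) (a b : ℤ), q * (n.factorial : ℚ) = a →
      q * (m.factorial : ℚ) = b → a • d n = b • d m := by
    intro q n m a b ha hb
    rcases le_total n m with h | h
    · obtain ⟨j, rfl⟩ := Nat.exists_eq_add_of_le h
      exact hle q n j a b ha hb
    · obtain ⟨j, rfl⟩ := Nat.exists_eq_add_of_le h
      exact (hle q m j b a hb ha).symm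
  have hraise : ∀ (q : ℚ) (j : ℕ), ∃ b : ℤ, q * ((q.den + j).factorial : ℚ) = b := by
    intro q j
    obtain ⟨t, ht, -⟩ := hstep q.den j
    refine ⟨(q.num * (q.den - 1).factorial) * t, ?_⟩
    rw [ht]
    push_cast
    have := hint q
    push_cast at this
    rw [← this]
    ring
  -- Any `n` for which `n!` clears the denominator gives the same value, by `hwd`; `n = q.den` is
  -- one such choice.
  let F : ℚ → D := fun q => (q.num * (q.den - 1).factorial : ℤ) • d q.den
  have hF : ∀ (q : ℚ) (n : ℕ) (a : ℤ), q * (n.factorial : ℚ) = a → F q = a • d n :=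
    fun q n a h => hwd q _ _ _ _ (hint q) h
  refine ⟨AddMonoidHom.mk' F fun p q => ?_, hF⟩
  obtain ⟨a, ha⟩ := hraise p q.den
  obtain ⟨b, hb⟩ := hraise q p.den
  rw [add_comm] at hb
  rw [hF p _ a ha, hF q _ b hb, ← add_smul]
  exact hF _ _ _ (by rw [add_mul, ha, hb]; push_cast; rfl)

/-- Homomorphisms from `ℚ` lift along a surjection `π` as soon as the systems
`x n = h n + (n + 1) • x (n + 1)` are solvable in the kernel of `π`. -/
theorem exists_lift_rat {D Q : Type*} [AddCommGroup D] [AddCommGroup Q] (π : D →+ Q)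
    (hπ : Function.Surjective π)
    (hker : ∀ h : ℕ → D, (∀ n, π (h n) = 0) →
      ∃ x : ℕ → D, (∀ n, π (x n) = 0) ∧ ∀ n, x n = h n + (n + 1) • x (n + 1))
    (φ : ℚ →+ Q) : ∃ ψ : ℚ →+ D, π.comp ψ = φ := by
  choose d hd using fun n : ℕ => hπ (φ (1 / (n.factorial : ℚ)))
  have hφ : ∀ n : ℕ, φ (1 / (n.factorial : ℚ)) =
      (n + 1) • φ (1 / ((n + 1).factorial : ℚ)) := by
    intro n
    rw [← map_nsmul]
    congr 1
    have h1 : (n.factorial : ℚ) ≠ 0 := by exact_mod_cast n.factorial_ne_zero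
    have h2 : (n : ℚ) + 1 ≠ 0 := by positivity
    rw [Nat.factorial_succ, nsmul_eq_mul]
    push_cast
    field_simp
  -- The arbitrary lifts `d n` are compatible only up to elements of the kernel; subtracting `x n`
  -- removes this defect.
  obtain ⟨x, hx0, hx⟩ := hker (fun n => d n - (n + 1) • d (n + 1)) fun n => by
    rw [map_sub, map_nsmul, hd, hd, ← hφ, sub_self]
  obtain ⟨ψ, hψ⟩ := exists_rat_addMonoidHom (fun n => d n - x n) fun n => by
    rw [hx n, smul_sub]
    abel
  refine ⟨ψ, AddMonoidHom.ext fun q => ?_⟩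
  have hq : q * (q.den.factorial : ℚ) = (q.num * (q.den - 1).factorial : ℤ) := by
    rw [← Nat.mul_factorial_pred q.den_nz]
    push_cast
    rw [← mul_assoc, Rat.mul_den_eq_num]
  rw [AddMonoidHom.comp_apply, hψ q _ _ hq, map_zsmul, map_sub, hd, hx0, sub_zero, ← map_zsmul]
  congr 1
  have h1 : (q.den.factorial : ℚ) ≠ 0 := by exact_mod_cast q.den.factorial_ne_zero
  rw [zsmul_eq_mul, ← hq]
  field_simp

/-- A `ℚ`-vector space is a direct sum of copies of `ℚ`, so lifts chosen separately on the basis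
lines assemble. -/
theorem exists_lift_rat_module {V D Q : Type*} [AddCommGroup V] [Module ℚ V] [AddCommGroup D]
    [AddCommGroup Q] (π : D →+ Q) (hπ : Function.Surjective π)
    (hker : ∀ h : ℕ → D, (∀ n, π (h n) = 0) →
      ∃ x : ℕ → D, (∀ n, π (x n) = 0) ∧ ∀ n, x n = h n + (n + 1) • x (n + 1))
    (φ : V →+ Q) : ∃ ψ : V →+ D, π.comp ψ = φ := by
  let b := Module.Basis.ofVectorSpace ℚ V
  let e : V ≃+ (_ →₀ ℚ) := b.repr.toAddEquiv
  choose ψ hψ using fun i => exists_lift_rat π hπ hker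
    ((φ.comp e.symm.toAddMonoidHom).comp (Finsupp.singleAddHom i))
  refine ⟨(Finsupp.liftAddHom ψ).comp e.toAddMonoidHom, ?_⟩
  have h : π.comp (Finsupp.liftAddHom ψ) = φ.comp e.symm.toAddMonoidHom := by
    refine Finsupp.addHom_ext fun i q => ?_
    simpa using DFunLike.congr_fun (hψ i) q
  ext x
  simpa using DFunLike.congr_fun h (e x)

/-- Characters into `ℚ/ℤ` separate points. The product of copies of `ℚ/ℤ` is divisible, which later
yields injectivity of its quotients. -/
theorem exists_injective_divisible (G : Type*) [AddCommGroup G] :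
    ∃ ι : G →+ (CharacterModule G → AddCircle (1 : ℚ)), Function.Injective ι := by
  refine ⟨AddMonoidHom.pi fun c => c, (injective_iff_map_eq_zero _).2 fun a ha => ?_⟩
  exact CharacterModule.eq_zero_of_character_apply fun c => congrFun ha c

/-- A surjection `f` onto a torsion-free abelian group has a homomorphic section as soon as the
systems `x n = h n + (n + 1) • x (n + 1)` are solvable in the kernel of `f`. -/
theorem exists_section_of_torsionFree {G Γ : Type*} [AddCommGroup G] [AddCommGroup Γ]
    [IsAddTorsionFree Γ] (f : G →+ Γ) (hf : Function.Surjective f)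
    (hker : ∀ h : ℕ → G, (∀ n, f (h n) = 0) →
      ∃ x : ℕ → G, (∀ n, f (x n) = 0) ∧ ∀ n, x n = h n + (n + 1) • x (n + 1)) :
    ∃ s : Γ →+ G, ∀ γ, f (s γ) = γ := by
  obtain ⟨ι, hι⟩ := exists_injective_divisible G
  have : Fact ((0 : ℚ) < 1) := ⟨one_pos⟩
  set D := CharacterModule G → AddCircle (1 : ℚ)
  let H : AddSubgroup D := f.ker.map ι
  let π : D →+ D ⧸ H := QuotientAddGroup.mk' H
  have hπ : Function.Surjective π := QuotientAddGroup.mk'_surjective H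
  have hπ0 : ∀ d, π d = 0 ↔ ∃ a, f a = 0 ∧ ι a = d := fun d => by
    simp only [π, QuotientAddGroup.mk'_apply, QuotientAddGroup.eq_zero_iff, H,
      AddSubgroup.mem_map, AddMonoidHom.mem_ker]
  have hkerπ : ∀ h : ℕ → D, (∀ n, π (h n) = 0) →
      ∃ x : ℕ → D, (∀ n, π (x n) = 0) ∧ ∀ n, x n = h n + (n + 1) • x (n + 1) := by
    intro h hh
    choose a ha0 ha using fun n => (hπ0 _).1 (hh n)
    obtain ⟨x, hx0, hx⟩ := hker a ha0
    refine ⟨fun n => ι (x n), fun n => (hπ0 _).2 ⟨_, hx0 n, rfl⟩, fun n => ?_⟩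
    dsimp only
    rw [hx n, map_add, map_nsmul, ha]
  -- Since `Γ` is `G / ker f`, the embedding `ι` induces `g`. A lift of `g` to `D` must take values
  -- in `ι(G)`, hence is a section; it is found by extending `g` to the divisible hull and lifting
  -- there.
  let g : Γ →+ D ⧸ H := f.liftOfSurjective hf ⟨π.comp ι, fun a ha =>
    (hπ0 _).2 ⟨a, ha, rfl⟩⟩
  have hg : ∀ a, g (f a) = π (ι a) := fun a =>
    AddMonoidHom.liftOfRightInverse_comp_apply _ _ _ _ a
  let _ : DivisibleBy D ℤ := Pi.divisibleBy _
  let _ : DivisibleBy D ℕ := AddGroup.divisibleByNatOfDivisibleByInt _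
  let _ : DivisibleBy (D ⧸ H) ℕ := QuotientAddGroup.divisibleBy H
  let _ : DivisibleBy (D ⧸ H) ℤ := AddGroup.divisibleByIntOfDivisibleByNat _
  obtain ⟨φ, hφ⟩ := (Module.Baer.of_divisible (D ⧸ H)).extension_property_addMonoidHom
    (DivisibleHull.coeAddMonoidHom Γ) DivisibleHull.coe_injective g
  obtain ⟨ψ, hψ⟩ := exists_lift_rat_module π hπ hkerπ φ
  have hex : ∀ γ, ∃ a, f a = γ ∧ ι a = ψ (DivisibleHull.coeAddMonoidHom Γ γ) := by
    intro γ
    obtain ⟨a, rfl⟩ := hf γ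
    have h1 : π (ψ (DivisibleHull.coeAddMonoidHom Γ (f a))) = π (ι a) := by
      rw [← hg, ← hφ, ← hψ]
      rfl
    rw [← sub_eq_zero, ← map_sub, hπ0] at h1
    obtain ⟨b, hb0, hb⟩ := h1
    exact ⟨b + a, by rw [map_add, hb0, zero_add], by rw [map_add, hb, sub_add_cancel]⟩
  choose s hs hsι using hex
  refine ⟨AddMonoidHom.mk' s fun γ δ => hι ?_, hs⟩
  rw [map_add, hsι, hsι, hsι, map_add, map_add]

/-! ### Definable relations and chains in saturated structures -/

namespace FirstOrder.Language

/-- `P` is defined by a parameter-free `L`-formula. -/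
def IsDefinable (L : Language.{0, 0}) {M : Type*} [L.Structure M] {α : Type}
    (P : (α → M) → Prop) : Prop :=
  ∃ φ : L.Formula α, ∀ w, φ.Realize w ↔ P w

namespace IsDefinable

variable {L : Language.{0, 0}} {M : Type*} [L.Structure M] {α β : Type}

theorem and {P Q : (α → M) → Prop} (hP : L.IsDefinable P) (hQ : L.IsDefinable Q) :
    L.IsDefinable fun w => P w ∧ Q w := by
  obtain ⟨φ, hφ⟩ := hP
  obtain ⟨ψ, hψ⟩ := hQ
  exact ⟨φ ⊓ ψ, fun w => by rw [Formula.realize_inf, hφ, hψ]⟩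

theorem comp {P : (α → M) → Prop} (hP : L.IsDefinable P) (g : α → β) :
    L.IsDefinable fun w : β → M => P (w ∘ g) := by
  obtain ⟨φ, hφ⟩ := hP
  exact ⟨φ.relabel g, fun w => by rw [Formula.realize_relabel, hφ]⟩

theorem ex {P : (α → M) → M → Prop}
    (hP : L.IsDefinable fun w : α ⊕ Unit → M => P (w ∘ Sum.inl) (w (Sum.inr ()))) :
    L.IsDefinable fun w => ∃ z, P w z := by
  obtain ⟨φ, hφ⟩ := hP
  refine ⟨φ.iExs Unit, fun w => ?_⟩
  rw [Formula.realize_iExs]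
  constructor
  · rintro ⟨i, hi⟩
    exact ⟨i (), (hφ _).1 hi⟩
  · rintro ⟨z, hz⟩
    exact ⟨fun _ => z, (hφ _).2 hz⟩

theorem eq (i j : α) : L.IsDefinable fun w : α → M => w i = w j :=
  ⟨(Term.var i).equal (Term.var j), fun w => by simp [Formula.realize_equal]⟩

theorem true : L.IsDefinable fun _ : α → M => True :=
  ⟨⊤, fun _ => by simp⟩

theorem rel {n : ℕ} (R : L.Relations n) (g : Fin n → α) :
    L.IsDefinable fun w : α → M => Structure.RelMap R (w ∘ g) :=
  ⟨R.formula fun i => Term.var (g i), fun w => by rw [Formula.realize_rel]; rfl⟩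

end IsDefinable

variable {L : Language.{0, 0}} {M : Type*} [L.Structure M]

/-- In an `ℵ₁`-saturated structure, a decreasing sequence of nonempty sets that are definable over
countably many parameters has nonempty intersection. -/
theorem IsSaturated.exists_forall (hM : L.IsSaturated M (Cardinal.aleph 1)) {ι : Type}
    [Countable ι] (a : ι → M) (P : ℕ → (ι → M) → M → Prop)
    (hP : ∀ m, L.IsDefinable fun w : ι ⊕ Unit → M => P m (w ∘ Sum.inl) (w (Sum.inr ())))
    (hanti : ∀ m y, P (m + 1) a y → P m a y) (hne : ∀ m, ∃ y, P m a y) :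
    ∃ y, ∀ m, P m a y := by
  choose φ hφ using hP
  let g : ι ⊕ Unit → Set.range a ⊕ Unit := Sum.map (Set.rangeFactorization a) id
  have hreal : ∀ m (y : M), ((φ m).relabel g).Realize (Sum.elim Subtype.val fun _ => y) ↔
      P m a y := by
    intro m y
    rw [Formula.realize_relabel, hφ]
    rfl
  have hle : ∀ y m n, m ≤ n → P n a y → P m a y := fun y m n hmn h =>
    Nat.decreasingInduction (motive := fun k _ => P k a y) (fun k _ hk => hanti k y hk) h hmn
  obtain ⟨y, hy⟩ := hM (Set.range a)
    (by
      have : Cardinal.mk (Set.range a) ≤ Cardinal.aleph0 :=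
        Cardinal.le_aleph0_iff_set_countable.2 (Set.countable_range a)
      exact this.trans_lt Cardinal.aleph0_lt_aleph_one)
    (Set.range fun m => (φ m).relabel g) (by
      intro q hq hfin
      choose! index hindex using hq
      -- The conditions decrease, so the one of largest index implies the finitely many others.
      obtain ⟨N, hN⟩ := (hfin.image index).bddAbove
      obtain ⟨y, hy⟩ := hne N
      refine ⟨y, fun ψ hψ => ?_⟩
      rw [← hindex hψ]
      exact (hreal _ y).2 (hle y _ N (hN ⟨ψ, hψ, rfl⟩) hy))
  exact ⟨y, fun m => (hreal m y).1 (hy _ ⟨m, rfl⟩)⟩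

/-- `y` starts a chain of length `m` for the relations `R n (a n), R (n + 1) (a (n + 1)), …`. -/
def HasChain (R : ℕ → M → M → M → Prop) (a : ℕ → M) : ℕ → ℕ → M → Prop
  | 0, _, _ => True
  | m + 1, n, y => ∃ z, R n (a n) y z ∧ HasChain R a m (n + 1) z

/-- Dropping the far end of a chain makes the conditions decreasing in the length, as
`IsSaturated.exists_forall` requires. -/
theorem HasChain.of_succ {R : ℕ → M → M → M → Prop} {a : ℕ → M} :
    ∀ {m n : ℕ} {y : M}, HasChain R a (m + 1) n y → HasChain R a m n y
  | 0, _, _, _ => trivial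
  | _ + 1, _, _, ⟨z, hz, h⟩ => ⟨z, hz, h.of_succ⟩

theorem isDefinable_hasChain {R : ℕ → M → M → M → Prop}
    (hR : ∀ n, L.IsDefinable fun w : Fin 3 → M => R n (w 0) (w 1) (w 2)) (m n : ℕ) :
    L.IsDefinable fun w : ℕ ⊕ Unit → M => HasChain R (w ∘ Sum.inl) m n (w (Sum.inr ())) := by
  induction m generalizing n with
  | zero => exact .true
  | succ m ih =>
    refine .ex (P := fun w z => R n (w (Sum.inl n)) (w (Sum.inr ())) z ∧
      HasChain R (w ∘ Sum.inl) m (n + 1) z) (.and ?_ ?_)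
    · exact (hR n).comp ![Sum.inl (Sum.inl n), Sum.inl (Sum.inr ()), Sum.inr ()]
    · exact (ih (n + 1)).comp (Sum.map Sum.inl id)

/-- In an `ℵ₁`-saturated structure, definable relations that admit arbitrarily long finite chains
admit an infinite chain. -/
theorem IsSaturated.exists_chain (hM : L.IsSaturated M (Cardinal.aleph 1))
    {R : ℕ → M → M → M → Prop}
    (hR : ∀ n, L.IsDefinable fun w : Fin 3 → M => R n (w 0) (w 1) (w 2)) (a : ℕ → M)
    (hfin : ∀ m, ∃ y, HasChain R a m 0 y) :
    ∃ x : ℕ → M, ∀ n, R n (a n) (x n) (x (n + 1)) := by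
  obtain ⟨x₀, hx₀⟩ := hM.exists_forall a (fun m w y => HasChain R w m 0 y)
    (fun m => isDefinable_hasChain hR m 0) (fun _ _ h => h.of_succ) hfin
  have hstep : ∀ n y, (∀ m, HasChain R a m n y) →
      ∃ z, R n (a n) y z ∧ ∀ m, HasChain R a m (n + 1) z := by
    intro n y hy
    -- The current point `y` joins the parameters, and one successor is found that starts chains of
    -- every length.
    obtain ⟨z, hz⟩ := hM.exists_forall (ι := ℕ ⊕ Unit) (Sum.elim a fun _ => y)
      (fun m w z => R n (w (Sum.inl n)) (w (Sum.inr ())) z ∧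
        HasChain R (w ∘ Sum.inl) m (n + 1) z)
      (fun m => .and ((hR n).comp ![Sum.inl (Sum.inl n), Sum.inl (Sum.inr ()), Sum.inr ()])
        ((isDefinable_hasChain hR m (n + 1)).comp (Sum.map Sum.inl id)))
      (fun _ _ h => ⟨h.1, h.2.of_succ⟩) (fun m => hy (m + 1))
    exact ⟨z, (hz 0).1, fun m => (hz m).2⟩
  choose! next hnext using hstep
  let x : ℕ → M := fun n => Nat.rec x₀ next n
  have hx : ∀ n m, HasChain R a m n (x n) := by
    intro n
    induction n with
    | zero => exact hx₀
    | succ n ih => exact (hnext n (x n) ih).2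
  exact ⟨x, fun n => (hnext n (x n) (hx n)).1⟩

end FirstOrder.Language

/-! ### Monotone differential-henselian fields -/

namespace ValDiff

section Henselian

variable {K Γ : Type*} [Field K] [AddCommGroup Γ] [LinearOrder Γ] [IsOrderedAddMonoid Γ]
  {v : AddValuation K (WithTop Γ)} {k : Subfield K}

theorem val_div_nonneg {a b : K} (h : v b ≤ v a) : 0 ≤ v (a / b) := by
  rcases eq_or_ne b 0 with rfl | hb
  · simp
  · have h1 : v b + 0 ≤ v b + v (a / b) := by
      rw [← v.map_mul, mul_div_cancel₀ _ hb, add_zero]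
      exact h
    exact (WithTop.add_le_add_iff_left ((AddValuation.ne_top_iff v).2 hb)).1 h1

theorem residue_eq_zero_iff (a : valRing v) :
    IsLocalRing.residue (valRing v) a = 0 ↔ 0 < v (a : K) := by
  rw [IsLocalRing.residue_eq_zero_iff]
  exact (Valuation.mem_maximalIdeal_iff _ _).trans Iff.rfl

variable [Differential K]

theorem IsMonotone.val_logDeriv_nonneg (hmono : IsMonotone v) (a : K) :
    0 ≤ v (Differential.logDeriv a) :=
  val_div_nonneg (hmono a)

/-- A linear differential equation `z′ + e z + 1 = 0` over the valuation ring of a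
differential-henselian field has a solution in the valuation ring. -/
theorem IsDHenselian.exists_linear (hdh : IsDHenselian v) {e : K} (he : 0 ≤ v e) :
    ∃ z, 0 ≤ v z ∧ z′ + e * z + 1 = 0 := by
  let e' : valRing v := ⟨e, he⟩
  obtain ⟨z, hz, h⟩ := hdh (MvPolynomial.X 1 + MvPolynomial.C e' * MvPolynomial.X 0 + 1) (by
    simp only [map_add, map_mul, MvPolynomial.map_X, MvPolynomial.map_C, map_one]
    apply le_antisymm
    · refine (MvPolynomial.totalDegree_add _ _).trans (max_le ?_ (by simp))
      refine (MvPolynomial.totalDegree_add _ _).trans (max_le (by simp) ?_)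
      exact (MvPolynomial.totalDegree_mul _ _).trans (by simp)
    -- The coefficient of `Y′` is `1`, so the degree cannot drop under reduction.
    · have := MvPolynomial.le_totalDegree (p := MvPolynomial.X 1 +
        MvPolynomial.C (IsLocalRing.residue (valRing v) e') * MvPolynomial.X 0 + 1)
        (s := Finsupp.single 1 1) (by
          rw [MvPolynomial.mem_support_iff]
          simp [MvPolynomial.coeff_X, MvPolynomial.coeff_C_mul, MvPolynomial.coeff_one,
            Finsupp.single_left_inj, eq_comm (a := (0 : ℕ →₀ ℕ))])
      simpa using this)
  refine ⟨z, hz, ?_⟩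
  simpa [e'] using h

/-- Every infinitesimal is the logarithmic derivative of a `1`-unit. -/
theorem exists_val_zero_deriv_eq (hmono : IsMonotone v) (hdh : IsDHenselian v) {ε : K}
    (hε : 0 < v ε) : ∃ u, v u = 0 ∧ u′ = -ε * u := by
  rcases eq_or_ne ε 0 with rfl | hε0
  · exact ⟨1, v.map_one, by simp⟩
  -- Substituting `u = 1 + ε * z` in `u′ = -ε * u` and dividing by `ε` gives this linear equation
  -- for `z`.
  obtain ⟨z, hz, h⟩ := hdh.exists_linear (e := ε′ / ε + ε)
    (v.map_le_add (hmono.val_logDeriv_nonneg ε) hε.le)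
  refine ⟨1 + ε * z, ?_, ?_⟩
  · rw [v.map_add_eq_of_lt_left, v.map_one]
    rw [v.map_one, v.map_mul]
    exact add_pos_of_pos_of_nonneg hε hz
  · have hz' : z′ = -((ε′ / ε + ε) * z) - 1 := by linear_combination h
    simp only [map_add, Derivation.leibniz, smul_eq_mul, Derivation.map_one_eq_zero, hz']
    field_simp
    ring

/-- Every value is attained at an element whose logarithmic derivative lies in the lift of the
residue field. -/
theorem exists_val_eq_logDeriv_mem (hv : IsValuedDifferentialField v) (hmono : IsMonotone v)
    (hlift : IsLift v k) (hdh : IsDHenselian v) (γ : Γ) :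
    ∃ a : K, a ≠ 0 ∧ v a = γ ∧ Differential.logDeriv a ∈ k := by
  obtain ⟨b, hb⟩ := hv.surj γ
  have hb0 : b ≠ 0 := (AddValuation.ne_top_iff v).1 (by rw [hb]; exact WithTop.coe_ne_top)
  let l : valRing v := ⟨Differential.logDeriv b, hmono.val_logDeriv_nonneg b⟩
  obtain ⟨c, hc⟩ := hlift.bijective.2 (IsLocalRing.residue (valRing v) l)
  have hε : 0 < v (Differential.logDeriv b - c) := by
    have := (residue_eq_zero_iff (l - ⟨c, hlift.le_valRing c c.2⟩)).1
      (by rw [map_sub, ← hc, sub_self])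
    exact this
  obtain ⟨u, hu, hu'⟩ := exists_val_zero_deriv_eq hmono hdh hε
  have hu0 : u ≠ 0 := (AddValuation.ne_top_iff v).1 (by rw [hu]; exact WithTop.zero_ne_top)
  refine ⟨b * u, mul_ne_zero hb0 hu0, by rw [v.map_mul, hb, hu, add_zero], ?_⟩
  have : Differential.logDeriv u = -(Differential.logDeriv b - c) := by
    rw [Differential.logDeriv, hu', mul_div_cancel_right₀ _ hu0]
  rw [Differential.logDeriv_mul _ _ hb0 hu0, this]
  simp

end Henselian

/-! ### Definability of the kernel and solution of systems by saturation -/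

section Definability

open FirstOrder.Language

variable {K Γ : Type*} [Field K] [Differential K] [AddCommGroup Γ] [LinearOrder Γ]
  [IsOrderedAddMonoid Γ] {v : AddValuation K (WithTop Γ)} {k : Subfield K}

/-- The units of the valuation ring with logarithmic derivative in `k`. -/
def IsLogUnit (v : AddValuation K (WithTop Γ)) (k : Subfield K) (a : K) : Prop :=
  v a = 0 ∧ ∃ c ∈ k, a′ = c * a

/-- The set of elements satisfying `IsLogUnit`, in the structure `((K, k), Γ; v)`. -/
def LogUnit (x : Pair v k) : Prop := ∃ a, x = .field a ∧ IsLogUnit v k a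

theorem isDefinable_logUnit {α : Type} (i : α) :
    lang.IsDefinable fun w : α → Pair v k => LogUnit (w i) := by
  -- The language has no constant for zero; `γ + γ = γ` expresses `γ = 0`.
  have h : lang.IsDefinable fun w : α → Pair v k =>
      (∃ γ, FirstOrder.Language.Structure.RelMap (L := lang) Rel.val ![w i, γ] ∧
        FirstOrder.Language.Structure.RelMap (L := lang) Rel.groupAdd ![γ, γ, γ]) ∧
      ∃ c, FirstOrder.Language.Structure.RelMap (L := lang) Rel.lift ![c] ∧
        ∃ d, FirstOrder.Language.Structure.RelMap (L := lang) Rel.deriv ![w i, d] ∧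
        FirstOrder.Language.Structure.RelMap (L := lang) Rel.fieldMul ![c, w i, d] := by
    refine .and (.ex (P := fun w γ => _ ∧ _) (.and ?_ ?_)) (.ex (P := fun w c => _ ∧ _) (.and ?_
      (.ex (P := fun w d => _ ∧ _) (.and ?_ ?_))))
    · convert IsDefinable.rel (L := lang) (M := Pair v k) Rel.val
        ![Sum.inl i, Sum.inr ()] using 3 with w
      ext j; fin_cases j <;> rfl
    · convert IsDefinable.rel (L := lang) (M := Pair v k) Rel.groupAdd
        ![(Sum.inr () : α ⊕ Unit), Sum.inr (), Sum.inr ()] using 3 with w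
      ext j; fin_cases j <;> rfl
    · convert IsDefinable.rel (L := lang) (M := Pair v k) Rel.lift
        ![(Sum.inr () : α ⊕ Unit)] using 3 with w
      ext j; fin_cases j; rfl
    · convert IsDefinable.rel (L := lang) (M := Pair v k) Rel.deriv
        ![Sum.inl (Sum.inl i), (Sum.inr () : (α ⊕ Unit) ⊕ Unit)] using 3 with w
      ext j; fin_cases j <;> rfl
    · convert IsDefinable.rel (L := lang) (M := Pair v k) Rel.fieldMul
        ![Sum.inl (Sum.inr ()), Sum.inl (Sum.inl i), (Sum.inr () : (α ⊕ Unit) ⊕ Unit)]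
        using 3 with w
      ext j; fin_cases j <;> rfl
  convert h using 2 with w
  constructor
  · rintro ⟨a, ha, hva, c, hc, hac⟩
    rw [ha]
    exact ⟨⟨.group 0, ⟨a, 0, hva, rfl, rfl⟩, ⟨0, 0, rfl, rfl, by simp⟩⟩,
      .field c, ⟨c, hc, rfl⟩, .field (a′), ⟨a, rfl, rfl⟩, ⟨c, a, rfl, rfl, by rw [hac]; rfl⟩⟩
  · rintro ⟨⟨_, ⟨a, γ, hva, ha, rfl⟩, ⟨δ, δ', h1, h2, h3⟩⟩,
      _, ⟨c, hc, rfl⟩, _, ⟨b, hb, rfl⟩, ⟨c', b', h4, h5, h6⟩⟩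
    simp only [Matrix.cons_val] at *
    rw [ha] at hb h5 ⊢
    cases h1; cases h2; cases hb; cases h4; cases h5
    have hγ : γ = 0 := by
      injection h3 with h3
      exact left_eq_add.1 h3
    refine ⟨a, rfl, by rw [hva, hγ]; rfl, c, hc, ?_⟩
    injection h6

/-- `x = h * y ^ j` in the field sort, expressed by iterated multiplication. -/
def MulPow : ℕ → Pair v k → Pair v k → Pair v k → Prop
  | 0, h, x, _ => x = h
  | j + 1, h, x, y => ∃ t, FirstOrder.Language.Structure.RelMap (L := lang) Rel.fieldMul
      ![h, y, t] ∧ MulPow j t x y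

theorem isDefinable_mulPow (j : ℕ) {α : Type} (p q r : α) :
    lang.IsDefinable fun w : α → Pair v k => MulPow j (w p) (w q) (w r) := by
  induction j generalizing α with
  | zero => exact .eq q p
  | succ j ih =>
    refine .ex (P := fun w t => FirstOrder.Language.Structure.RelMap (L := lang) Rel.fieldMul
      ![w p, w r, t] ∧ MulPow j t (w q) (w r)) (.and ?_ (ih (Sum.inr ()) (Sum.inl q) (Sum.inl r)))
    convert IsDefinable.rel (L := lang) (M := Pair v k) Rel.fieldMul
        ![Sum.inl p, Sum.inl r, Sum.inr ()] using 3 with w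
    ext i; fin_cases i <;> rfl

theorem mulPow_field (j : ℕ) (h a b : K) :
    MulPow j (.field h : Pair v k) (.field a) (.field b) ↔ a = h * b ^ j := by
  induction j generalizing h with
  | zero => simp [MulPow]
  | succ j ih =>
    rw [MulPow, pow_succ', ← mul_assoc, ← ih]
    constructor
    · rintro ⟨t, ⟨c, d, h1, h2, h3⟩, ht⟩
      simp only [Matrix.cons_val] at h1 h2 h3
      cases h1; cases h2; cases h3
      exact ht
    · exact fun ht => ⟨_, ⟨h, b, rfl, rfl, rfl⟩, ht⟩

/-- By saturation, the systems `x n = h n * x (n + 1) ^ (n + 1)` are solvable among the units with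
logarithmic derivative in `k`. -/
theorem exists_isLogUnit_seq (hsat : lang.IsSaturated (Pair v k) (Cardinal.aleph 1)) (h : ℕ → K)
    (hh : ∀ n, IsLogUnit v k (h n)) :
    ∃ x : ℕ → K, (∀ n, IsLogUnit v k (x n)) ∧ ∀ n, x n = h n * x (n + 1) ^ (n + 1) := by
  have hone : IsLogUnit v k 1 := ⟨v.map_one, 0, k.zero_mem, by simp⟩
  have hmul : ∀ {a b}, IsLogUnit v k a → IsLogUnit v k b → IsLogUnit v k (a * b) := by
    rintro a b ⟨ha, c, hc, hac⟩ ⟨hb, d, hd, hbd⟩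
    refine ⟨by rw [v.map_mul, ha, hb, add_zero], c + d, k.add_mem hc hd, ?_⟩
    rw [Derivation.leibniz, hac, hbd, smul_eq_mul, smul_eq_mul]
    ring
  have hpow : ∀ {a} (n : ℕ), IsLogUnit v k a → IsLogUnit v k (a ^ n) := by
    intro a n ha
    induction n with
    | zero => rwa [pow_zero]
    | succ n ih => rw [pow_succ]; exact hmul ih ha
  let R : ℕ → Pair v k → Pair v k → Pair v k → Prop := fun n h x y =>
    (LogUnit x ∧ LogUnit y) ∧ MulPow (n + 1) h x y
  -- Chains are built from the far end: start with `1` and put `h n * b ^ (n + 1)` in front of `b`.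
  have hchain : ∀ m n, ∃ a, IsLogUnit v k a ∧
      HasChain R (fun n => .field (h n)) m n (.field a) := by
    intro m
    induction m with
    | zero => exact fun n => ⟨1, hone, trivial⟩
    | succ m ih =>
      intro n
      obtain ⟨b, hb, hbc⟩ := ih (n + 1)
      have ha := hmul (hh n) (hpow (n + 1) hb)
      exact ⟨_, ha, .field b, ⟨⟨⟨_, rfl, ha⟩, ⟨_, rfl, hb⟩⟩, (mulPow_field _ _ _ _).2 rfl⟩, hbc⟩
  obtain ⟨x, hx⟩ := hsat.exists_chain (R := R)
    (fun n => .and (.and (isDefinable_logUnit 1) (isDefinable_logUnit 2))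
      (isDefinable_mulPow (n + 1) 0 1 2)) (fun n => .field (h n))
    (fun m => let ⟨a, _, ha⟩ := hchain m 0; ⟨_, ha⟩)
  choose a hxa ha using fun n => (hx n).1.1
  refine ⟨a, ha, fun n => ?_⟩
  have := (hx n).2
  rw [hxa n, hxa (n + 1)] at this
  exact (mulPow_field _ _ _ _).1 this

end Definability

/-! ### The group of elements with logarithmic derivative in `k` -/

section CrossSection

variable {K Γ : Type*} [Field K] [AddCommGroup Γ] [LinearOrder Γ] [IsOrderedAddMonoid Γ]

theorem val_ne_top (v : AddValuation K (WithTop Γ)) (a : Kˣ) : v (a : K) ≠ ⊤ :=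
  (AddValuation.ne_top_iff v).2 a.ne_zero

/-- The valuation as a homomorphism on the units of `K`. -/
def valUnits (v : AddValuation K (WithTop Γ)) : Additive Kˣ →+ Γ :=
  AddMonoidHom.mk' (fun a => (v (a.toMul : K)).untop (val_ne_top v a.toMul)) fun a b =>
    WithTop.coe_injective (by
      rw [WithTop.coe_add, WithTop.coe_untop, WithTop.coe_untop, WithTop.coe_untop, toMul_add,
        Units.val_mul, v.map_mul])

theorem coe_valUnits (v : AddValuation K (WithTop Γ)) (a : Additive Kˣ) :
    (valUnits v a : WithTop Γ) = v (a.toMul : K) :=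
  WithTop.coe_untop _ _

variable [Differential K]

/-- The group of nonzero elements with logarithmic derivative in `k`. -/
def logDerivSubgroup (k : Subfield K) : Subgroup Kˣ where
  carrier := {a | Differential.logDeriv (a : K) ∈ k}
  one_mem' := by simp
  mul_mem' {a b} ha hb := by
    rw [Set.mem_ofPred_eq, Units.val_mul, Differential.logDeriv_mul _ _ a.ne_zero b.ne_zero]
    exact k.add_mem ha hb
  inv_mem' {a} ha := by
    have := Differential.logDeriv_mul _ _ a.ne_zero a⁻¹.ne_zero
    rw [Units.mul_inv, Differential.logDeriv_one] at this
    rw [Set.mem_ofPred_eq, eq_neg_of_add_eq_zero_right this.symm]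
    exact k.neg_mem ha

theorem mem_logDerivSubgroup {k : Subfield K} {a : Kˣ} :
    a ∈ logDerivSubgroup k ↔ Differential.logDeriv (a : K) ∈ k := Iff.rfl

end CrossSection

end ValDiff

theorem theorem3p5 {K Γ : Type*} [Field K] [Differential K]
    [AddCommGroup Γ] [LinearOrder Γ] [IsOrderedAddMonoid Γ]
    (v : AddValuation K (WithTop Γ)) (k : Subfield K)
    (hv : ValDiff.IsValuedDifferentialField v)
    (hmono : ValDiff.IsMonotone v)
    (hlift : ValDiff.IsLift v k)
    (hdh : ValDiff.IsDHenselian v)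
    (hsat : ValDiff.lang.IsSaturated (ValDiff.Pair v k) (Cardinal.aleph 1)) :
    ∃ (s : Multiplicative Γ →* Kˣ) (c : Γ →+ k),
      ValDiff.IsCrossSection v s ∧
      ∀ γ : Γ, Differential.logDeriv (s (Multiplicative.ofAdd γ) : K) = (c γ : K) := by
  let G := ValDiff.logDerivSubgroup k
  let f : Additive G →+ Γ := (ValDiff.valUnits v).comp G.subtype.toAdditive
  have hf : ∀ a : Additive G, (f a : WithTop Γ) = v ((a.toMul : Kˣ) : K) := fun a =>
    ValDiff.coe_valUnits v _
  have hsurj : Function.Surjective f := by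
    intro γ
    obtain ⟨a, ha0, hva, ha⟩ := ValDiff.exists_val_eq_logDeriv_mem hv hmono hlift hdh γ
    exact ⟨Additive.ofMul ⟨Units.mk0 a ha0, ha⟩, WithTop.coe_injective ((hf _).trans hva)⟩
  -- The kernel of `f` consists of the elements satisfying `IsLogUnit`, so the multiplicative
  -- systems solved by saturation are the required additive ones.
  obtain ⟨s, hs⟩ := exists_section_of_torsionFree f hsurj fun h hh => by
    obtain ⟨x, hxu, hx⟩ := ValDiff.exists_isLogUnit_seq hsat
      (fun n => (((h n).toMul : Kˣ) : K)) fun n => by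
        refine ⟨by rw [← hf, hh]; rfl, _, (h n).toMul.2, ?_⟩
        rw [Differential.logDeriv, div_mul_cancel₀ _ (Units.ne_zero _)]
    have hx0 : ∀ n, x n ≠ 0 := fun n =>
      (AddValuation.ne_top_iff v).1 (by rw [(hxu n).1]; exact WithTop.zero_ne_top)
    have hxG : ∀ n, Units.mk0 (x n) (hx0 n) ∈ G := fun n => by
      obtain ⟨-, c, hc, hxc⟩ := hxu n
      rw [ValDiff.mem_logDerivSubgroup, Units.val_mk0, Differential.logDeriv, hxc,
        mul_div_cancel_right₀ _ (hx0 n)]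
      exact hc
    refine ⟨fun n => Additive.ofMul ⟨_, hxG n⟩,
      fun n => WithTop.coe_injective ((hf _).trans (hxu n).1), fun n => ?_⟩
    exact Additive.toMul.injective (Subtype.ext (Units.ext (hx n)))
  have hsmem : ∀ γ, Differential.logDeriv (((s γ).toMul : Kˣ) : K) ∈ k := fun γ => (s γ).toMul.2
  refine ⟨AddMonoidHom.toMultiplicativeLeft (G.subtype.toAdditive.comp s),
    AddMonoidHom.mk' (fun γ => ⟨_, hsmem γ⟩) fun γ δ => Subtype.ext ?_, fun γ => ?_, fun γ => rfl⟩
  · change Differential.logDeriv (((s (γ + δ)).toMul : Kˣ) : K) = _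
    rw [map_add]
    exact Differential.logDeriv_mul _ _ (Units.ne_zero _) (Units.ne_zero _)
  · exact (hf (s γ)).symm.trans (congrArg _ (hs γ))
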